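/- A \emph{distance space} is a set $X$ with a function $d:X\times X\to[0,\infty]$ that satisfies the axioms of a metric, the value $\infty$ being allowed; it carries the topology and the Borel $\sigma$-algebra generated by its open balls in the usual way. For $A\subseteq X$ and $\varepsilon>0$ put $A^{\varepsilon}=\{x\in X:\exists a\in A,\ d(x,a)<\varepsilon\}$. A \emph{distance measure space} $(X,d,\mu)$ is a distance space with a finite regular Borel measure. For finite Borel measures $\mu,\nu$ on a distance space $Z$ let $$d_\pi(\mu,\nu)=\inf\{\varepsilon>0:\ \mu(A)\le\nu(A^{\varepsilon})+\varepsilon\text{ and }\nu(A)\le\mu(A^{\varepsilon})+\varepsilon\text{ for all Borel }A\subseteq Z\}.$$ For $L>0$ and $\varepsilon\ge 0$, a measurable map $f$ from a distance measure space $(X,d,\mu)$ to a distance space $(Z,d')$ is an \emph{$L$-isometric $\varepsilon$-embedding} if there is $E\subseteq X$ with $\mu(E)\le\varepsilon$ such that, for all $x,y\in X\setminus E$, $d'(f(x),f(y))=d(x,y)$ whenever $\min\{d'(f(x),f(y)),d(x,y)\}<L$. The \emph{generalised Gromov--Hausdorff--Levy--Prokhorov distance} of two distance measure spaces is $$d_\rho\big((X_1,d_1,\mu_1),(X_2,d_2,\mu_2)\big)=\inf\Big\{d_\pi\big((f_1)_*\mu_1,(f_2)_*\mu_2\big)+\tfrac1L+\varepsilon\Big\},$$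 the infimum being over all distance spaces $Z$, all real $L>0$ and $\varepsilon\ge0$, and all $L$-isometric $\varepsilon$-embeddings $f_i:X_i\to Z$, $i=1,2$. \textbf{Theorem.} Let $M\ge0$ and let $\mathfrak F$ be a family of complete separable distance measure spaces with $\mu(X)\le M$ for all $(X,d,\mu)\in\mathfrak F$. Suppose that for every $\varepsilon>0$ there is a natural number $N(\varepsilon)$ such that every $(X,d,\mu)\in\mathfrak F$ contains a finite set $S\subseteq X$ with $|S|\le N(\varepsilon)$ and $\mu\big(X\setminus S^{\varepsilon}\big)\le\varepsilon$. Then: (1) $\mathfrak F$ is totally bounded for $d_\rho$: for every $\varepsilon>0$ there is a finite subset $F\subseteq\mathfrak F$ such that every member of $\mathfrak F$ is at $d_\rho$-distance less than $\varepsilon$ from some member of $F$. (2) Hence $\mathfrak F$ is precompact: every sequence in $\mathfrak F$ has a subsequence that converges for $d_\rho$ to a complete separable distance measure space, and the closure of $\mathfrak F$ in the space of all complete separable distance measure spaces is compact. Here a set $U$ of such spaces is open if for each $X\in U$ there is $\varepsilon>0$ such that $U$ contains every $Y$ with $d_\rho(X,Y)<\varepsilon$. -/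

import Mathlib

open MeasureTheory Set Filter Topology
open scoped NNReal ENNReal

universe u

/-- A distance measure space: a set with a distance taking values in `[0, ∞]` (an extended metric),
together with a finite regular Borel measure. -/
structure DistanceMeasureSpace : Type (u + 1) where
  carrier : Type u
  [toEMetricSpace : EMetricSpace carrier]
  [toMeasurableSpace : MeasurableSpace carrier]
  [toBorelSpace : BorelSpace carrier]
  μ : Measure carrier
  [isFiniteMeasure : IsFiniteMeasure μ]
  [regular : μ.Regular]

namespace DistanceMeasureSpace

instance : CoeSort DistanceMeasureSpace.{u} (Type u) := ⟨carrier⟩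

attribute [instance] toEMetricSpace toMeasurableSpace toBorelSpace isFiniteMeasure regular

end DistanceMeasureSpace

/-- `f` restricted to `A` is an `L`-isometric embedding: `d'(f x, f y) = d(x, y)` as soon as one of
the two distances is smaller than `L`. -/
def IsLIsometricOn {X Z : Type*} [EMetricSpace X] [EMetricSpace Z] (L : ℝ≥0) (f : X → Z)
    (A : Set X) : Prop :=
  ∀ x ∈ A, ∀ y ∈ A, min (edist (f x) (f y)) (edist x y) < (L : ℝ≥0∞) →
    edist (f x) (f y) = edist x y

/-- `f` is a (measurable) `L`-isometric `ε`-embedding of a distance measure space into a distance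
space: it is an `L`-isometric embedding off a set of measure at most `ε`. -/
def IsLIsometricEpsEmbedding (X : DistanceMeasureSpace.{u}) {Z : Type u} [EMetricSpace Z]
    [MeasurableSpace Z] (L ε : ℝ≥0) (f : X → Z) : Prop :=
  Measurable f ∧ ∃ E : Set X, X.μ E ≤ (ε : ℝ≥0∞) ∧ IsLIsometricOn L f Eᶜ

/-- The generalised Gromov-Hausdorff-Levy-Prokhorov distance `d_ρ`: the infimum of
`d_π(f_* μ_X, g_* μ_Y) + 1 / L + ε` over all distance spaces `Z` with their Borel σ-algebra,
all real `L > 0`, `ε ≥ 0`, and all `L`-isometric `ε`-embeddings `f : X → Z`, `g : Y → Z`. -/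
noncomputable def ghlpDist (X Y : DistanceMeasureSpace.{u}) : ℝ≥0∞ :=
  sInf {r : ℝ≥0∞ | ∃ (Z : Type u) (_ : EMetricSpace Z) (_ : MeasurableSpace Z) (_ : BorelSpace Z)
    (L ε : ℝ≥0) (f : X → Z) (g : Y → Z), 0 < L ∧
      IsLIsometricEpsEmbedding X L ε f ∧ IsLIsometricEpsEmbedding Y L ε g ∧
      r = levyProkhorovEDist (X.μ.map f) (Y.μ.map g) + 1 / (L : ℝ≥0∞) + (ε : ℝ≥0∞)}

/-- Complete separable distance measure spaces. -/
def CompleteSeparableDMS : Type (u + 1) :=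
  {X : DistanceMeasureSpace.{u} // CompleteSpace X ∧ TopologicalSpace.SeparableSpace X}

/-- The topology of `d_ρ`: a set is open if and only if it contains, with each of its points,
a `d_ρ`-ball of positive radius centred there. -/
instance : TopologicalSpace CompleteSeparableDMS.{u} where
  IsOpen U := ∀ X ∈ U, ∃ ε : ℝ≥0∞, 0 < ε ∧ ∀ Y, ghlpDist X.1 Y.1 < ε → Y ∈ U
  isOpen_univ := fun _ _ => ⟨1, one_pos, fun _ _ => mem_univ _⟩
  isOpen_inter := by
    rintro U V hU hV X ⟨hXU, hXV⟩
    obtain ⟨a, ha, hU'⟩ := hU X hXU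
    obtain ⟨b, hb, hV'⟩ := hV X hXV
    exact ⟨min a b, lt_min ha hb, fun Y hY =>
      ⟨hU' Y (hY.trans_le (min_le_left _ _)), hV' Y (hY.trans_le (min_le_right _ _))⟩⟩
  isOpen_sUnion := by
    rintro s hs X ⟨U, hU, hXU⟩
    obtain ⟨a, ha, h⟩ := hs U hU X hXU
    exact ⟨a, ha, fun Y hY => ⟨U, hU, h Y hY⟩⟩

/-! Sequential precompactness is the core. At scale `2⁻ᵏ` every space is reduced, up to small mass,
to finitely many centres and the index of the ball containing a point. Along an ultrafilter the
distances between centres converge in the compact `[0, ∞]`, and the laws of the index sequences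
converge on a compact product of finite sets. The limit distances are realised in a complete
separable `Y` (`exists_complete_separable_realization`). Under the limit law `ν` the indexed points
of `Y` almost surely form a Cauchy sequence, and the law of its limit `T` is the limit measure
(`exists_measurable_limit_of_indices`), so no tightness argument in `Y` is needed.
`ghlpDist_le_of_discretization` then bounds the distance to `Y`. For `d_ρ` only the weak triangle
inequality `ghlpDist_le_two_mul_add` is proved. It yields a countably generated uniformity, so
sequential precompactness gives total boundedness and compact closure. -/

/-! ### Lévy–Prokhorov estimates. -/

section LevyProkhorov

variable {Ω Z Z' : Type*} [MeasurableSpace Ω] [PseudoEMetricSpace Z] [MeasurableSpace Z]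
  [PseudoEMetricSpace Z'] [MeasurableSpace Z']

/-- Two maps that are `δ`-close off a set of measure at most `δ` have `δ`-close laws. -/
lemma levyProkhorovEDist_map_map_le [OpensMeasurableSpace Z] (m : Measure Ω) {a b : Ω → Z}
    (ha : Measurable a) (hb : Measurable b) {δ : ℝ≥0∞} {s : Set Ω} (hs : m s ≤ δ)
    (h : ∀ ω ∉ s, edist (a ω) (b ω) ≤ δ) :
    levyProkhorovEDist (m.map a) (m.map b) ≤ δ := by
  have key : ∀ {a b : Ω → Z}, Measurable a → Measurable b →
      (∀ ω ∉ s, edist (a ω) (b ω) ≤ δ) → ∀ (ε : ℝ≥0∞) (B : Set Z), δ < ε → ε < ∞ →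
      MeasurableSet B → m.map a B ≤ m.map b (Metric.thickening ε.toReal B) + ε := by
    intro a b ha hb h ε B hδ hε hB
    rw [Measure.map_apply ha hB, Measure.map_apply hb Metric.isOpen_thickening.measurableSet]
    calc m (a ⁻¹' B) ≤ m (b ⁻¹' Metric.thickening ε.toReal B ∪ s) := by
          refine measure_mono fun ω hω => ?_
          by_cases hωs : ω ∈ s
          · exact Or.inr hωs
          · refine Or.inl ((Metric.mem_thickening_iff_exists_edist_lt _ _).2 ⟨a ω, hω, ?_⟩)
            rw [ENNReal.ofReal_toReal hε.ne, edist_comm]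
            exact (h ω hωs).trans_lt hδ
      _ ≤ _ := (measure_union_le _ _).trans (by gcongr; exact hs.trans hδ.le)
  refine levyProkhorovEDist_le_of_forall _ _ _ fun ε B hδ hε hB => ⟨key ha hb h ε B hδ hε hB,
    key hb ha (fun ω hω => ?_) ε B hδ hε hB⟩
  rw [edist_comm]
  exact h ω hω

lemma levyProkhorovEDist_map_le_of_lipschitz [OpensMeasurableSpace Z] [OpensMeasurableSpace Z']
    [BorelSpace Z'] {i : Z → Z'} (hi : LipschitzWith 1 i) (μ ν : Measure Z) :
    levyProkhorovEDist (μ.map i) (ν.map i) ≤ levyProkhorovEDist μ ν := by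
  have hm : Measurable i := hi.continuous.measurable
  have hsub : ∀ (r : ℝ) (B : Set Z'),
      Metric.thickening r (i ⁻¹' B) ⊆ i ⁻¹' Metric.thickening r B := by
    intro r B x hx
    obtain ⟨z, hz, hxz⟩ := (Metric.mem_thickening_iff_exists_edist_lt _ _).1 hx
    refine (Metric.mem_thickening_iff_exists_edist_lt _ _).2 ⟨i z, hz, lt_of_le_of_lt ?_ hxz⟩
    simpa using hi x z
  refine levyProkhorovEDist_le_of_forall _ _ _ fun ε B hδ hε hB => ?_
  simp only [Measure.map_apply hm hB, Measure.map_apply hm Metric.isOpen_thickening.measurableSet]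
  constructor
  · exact (left_measure_le_of_levyProkhorovEDist_lt hδ (hm hB)).trans
      (by gcongr; exact hsub _ _)
  · exact (right_measure_le_of_levyProkhorovEDist_lt hδ (hm hB)).trans
      (by gcongr; exact hsub _ _)

lemma levyProkhorovEDist_le_of_forall_measure_le {μ ν : Measure Z} {δ : ℝ≥0∞}
    (h : ∀ B, MeasurableSet B → μ B ≤ ν B + δ ∧ ν B ≤ μ B + δ) :
    levyProkhorovEDist μ ν ≤ δ := by
  refine levyProkhorovEDist_le_of_forall _ _ _ fun ε B hδ hε hB => ?_
  have hsub : B ⊆ Metric.thickening ε.toReal B :=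
    Metric.self_subset_thickening (ENNReal.toReal_pos (bot_le.trans_lt hδ).ne' hε.ne) B
  exact ⟨(h B hB).1.trans (by gcongr), (h B hB).2.trans (by gcongr)⟩

end LevyProkhorov

/-! ### Truncating and glueing distance spaces. -/

section Glueing

/-- Equality of truncated distances, unlike the conditional form, passes directly to smaller `L` and
to compositions. -/
lemma isLIsometricOn_iff {X Z : Type*} [EMetricSpace X] [EMetricSpace Z] {L : ℝ≥0} {f : X → Z}
    {A : Set X} : IsLIsometricOn L f A ↔
      ∀ x ∈ A, ∀ y ∈ A, min (edist (f x) (f y)) (L : ℝ≥0∞) = min (edist x y) L := by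
  refine forall₄_congr fun x _ y _ => ?_
  constructor
  · intro h
    by_cases hlt : min (edist (f x) (f y)) (edist x y) < (L : ℝ≥0∞)
    · rw [h hlt]
    · rw [not_lt, le_min_iff] at hlt
      rw [min_eq_right hlt.1, min_eq_right hlt.2]
  · intro h hlt
    rcases min_lt_iff.1 hlt with h1 | h1
    · rw [min_eq_left h1.le] at h
      rcases min_choice (edist x y) (L : ℝ≥0∞) with h2 | h2
      · rw [h, h2]
      · rw [h, h2] at h1
        exact absurd h1 (lt_irrefl _)
    · rw [min_eq_left h1.le] at h
      rcases min_choice (edist (f x) (f y)) (L : ℝ≥0∞) with h2 | h2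
      · rw [← h, h2]
      · rw [← h, h2] at h1
        exact absurd h1 (lt_irrefl _)

/-- Truncating an extended metric at `L` gives a metric. -/
lemma exists_metricSpace_truncation (A : Type u) [EMetricSpace A] {L : ℝ≥0} (hL : 0 < L) :
    ∃ (A' : Type u) (_ : MetricSpace A') (t : A → A'),
      ∀ x y, edist (t x) (t y) = min (edist x y) L := by
  have hfin : ∀ x y : A, min (edist x y) (L : ℝ≥0∞) ≠ ∞ := fun x y =>
    ((min_le_right _ _).trans_lt ENNReal.coe_lt_top).ne
  let m : MetricSpace A :=
    { dist := fun x y => (min (edist x y) (L : ℝ≥0∞)).toReal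
      dist_self := fun x => by simp
      dist_comm := fun x y => by rw [edist_comm]
      dist_triangle := fun x y z => by
        rw [← ENNReal.toReal_add (hfin _ _) (hfin _ _)]
        refine ENNReal.toReal_mono (ENNReal.add_ne_top.2 ⟨hfin _ _, hfin _ _⟩) ?_
        rcases le_total (edist x y) L with h1 | h1
        · rcases le_total (edist y z) L with h2 | h2
          · rw [min_eq_left h1, min_eq_left h2]
            exact (min_le_left _ _).trans (edist_triangle _ _ _)
          · rw [min_eq_right h2]
            exact (min_le_right _ _).trans le_add_self
        · rw [min_eq_right h1]
          exact (min_le_right _ _).trans le_self_add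
      eq_of_dist_eq_zero := fun {x y} h => by
        have h' := (ENNReal.toReal_eq_zero_iff _).1 h
        rcases h' with h' | h'
        · rcases min_eq_bot.1 (h' : _ = ⊥) with h0 | h0
          · exact edist_eq_zero.1 h0
          · exact absurd h0 (by simpa using hL.ne')
        · exact absurd h' (hfin _ _) }
  refine ⟨A, m, id, fun x y => ?_⟩
  rw [@edist_dist A m.toPseudoMetricSpace]
  exact ENNReal.ofReal_toReal (hfin x y)

/-- Two distance spaces, truncated at `L`, can be glued along two families of points with nearly the
same truncated distances, so that corresponding points become close. -/
lemma exists_truncated_glueing (A B : Type u) [EMetricSpace A] [EMetricSpace B] {L δ : ℝ≥0}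
    (hL : 0 < L) (hδ : 0 < δ) {ι : Type*} (Φ : ι → A) (Ψ : ι → B)
    (h : ∀ p q, min (edist (Φ p) (Φ q)) (L : ℝ≥0∞) ≤ min (edist (Ψ p) (Ψ q)) L + 2 * δ)
    (h' : ∀ p q, min (edist (Ψ p) (Ψ q)) (L : ℝ≥0∞) ≤ min (edist (Φ p) (Φ q)) L + 2 * δ) :
    ∃ (Z : Type u) (_ : EMetricSpace Z) (i : A → Z) (j : B → Z),
      (∀ x y, edist (i x) (i y) = min (edist x y) L) ∧
      (∀ x y, edist (j x) (j y) = min (edist x y) L) ∧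
      ∀ p, edist (i (Φ p)) (j (Ψ p)) ≤ δ := by
  -- `Metric.glueMetricApprox` needs real distances, hence the truncation.
  obtain ⟨A', mA, s, hs⟩ := exists_metricSpace_truncation A hL
  obtain ⟨B', mB, t, ht⟩ := exists_metricSpace_truncation B hL
  -- The glued distance is an infimum over `ι`; with no points to match, a disjoint union serves.
  rcases isEmpty_or_nonempty ι with hι | hι
  · let _ := Metric.metricSpaceSum (X := A') (Y := B')
    exact ⟨A' ⊕ B', inferInstance, Sum.inl ∘ s, Sum.inr ∘ t,
      fun x y => (Metric.isometry_inl.edist_eq _ _).trans (hs x y),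
      fun x y => (Metric.isometry_inr.edist_eq _ _).trans (ht x y), fun p => isEmptyElim p⟩
  · have hreal : ∀ {a b : ℝ}, 0 ≤ a → 0 ≤ b →
        ENNReal.ofReal a ≤ ENNReal.ofReal b + 2 * δ → a ≤ b + 2 * δ := by
      intro a b ha hb hab
      have h2 : (2 : ℝ≥0∞) * δ = ENNReal.ofReal (2 * δ) := by
        rw [ENNReal.ofReal_mul zero_le_two, ENNReal.ofReal_ofNat, ENNReal.ofReal_coe_nnreal]
      rw [h2, ← ENNReal.ofReal_add hb (by positivity)] at hab
      exact (ENNReal.ofReal_le_ofReal_iff (by positivity)).1 hab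
    have H : ∀ p q, |dist (s (Φ p)) (s (Φ q)) - dist (t (Ψ p)) (t (Ψ q))| ≤ 2 * (δ : ℝ) := by
      intro p q
      have h1 := h p q
      have h2 := h' p q
      rw [← hs, ← ht, edist_dist, edist_dist] at h1 h2
      have h3 := hreal dist_nonneg dist_nonneg h1
      have h4 := hreal dist_nonneg dist_nonneg h2
      rw [abs_le]
      constructor <;> linarith
    let m := Metric.glueMetricApprox (s ∘ Φ) (t ∘ Ψ) (δ : ℝ) (by exact_mod_cast hδ) H
    have hl : Isometry (Sum.inl : A' → A' ⊕ B') := Isometry.of_dist_eq fun _ _ => rfl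
    have hr : Isometry (Sum.inr : B' → A' ⊕ B') := Isometry.of_dist_eq fun _ _ => rfl
    refine ⟨A' ⊕ B', inferInstance, Sum.inl ∘ s, Sum.inr ∘ t,
      fun x y => (hl.edist_eq _ _).trans (hs x y),
      fun x y => (hr.edist_eq _ _).trans (ht x y), fun p => ?_⟩
    rw [edist_dist]
    refine ENNReal.ofReal_le_of_le_toReal (le_of_eq ?_)
    exact Metric.glueDist_glued_points (s ∘ Φ) (t ∘ Ψ) (δ : ℝ) p

end Glueing

/-! ### The distance `d_ρ` and its weak triangle inequality. -/

section GHLP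

lemma lipschitzWith_one_of_edist_eq_min {A Z : Type*} [EMetricSpace A] [EMetricSpace Z]
    {L : ℝ≥0∞} {i : A → Z} (hi : ∀ x y, edist (i x) (i y) = min (edist x y) L) :
    LipschitzWith 1 i := fun x y => by
  rw [hi, ENNReal.coe_one, one_mul]
  exact min_le_left _ _

lemma ghlpDist_le {X Y : DistanceMeasureSpace.{u}} {Z : Type u} [EMetricSpace Z]
    [MeasurableSpace Z] [BorelSpace Z] {L ε : ℝ≥0} (hL : 0 < L) {f : X → Z} {g : Y → Z}
    (hf : IsLIsometricEpsEmbedding X L ε f) (hg : IsLIsometricEpsEmbedding Y L ε g) :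
    ghlpDist X Y ≤ levyProkhorovEDist (X.μ.map f) (Y.μ.map g) + 1 / (L : ℝ≥0∞) + ε :=
  sInf_le ⟨Z, _, _, inferInstance, L, ε, f, g, hL, hf, hg, rfl⟩

lemma ghlpDist_comm (X Y : DistanceMeasureSpace.{u}) : ghlpDist X Y = ghlpDist Y X := by
  unfold ghlpDist
  congr 1
  ext r
  constructor <;>
  · rintro ⟨Z, i1, i2, i3, L, ε, f, g, hL, hf, hg, rfl⟩
    exact ⟨Z, i1, i2, i3, L, ε, g, f, hL, hg, hf, by rw [levyProkhorovEDist_comm]⟩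

lemma eq_zero_of_forall_le_inv {r : ℝ≥0∞} (h : ∀ L : ℝ≥0, 0 < L → r ≤ 1 / (L : ℝ≥0∞)) :
    r = 0 := by
  refine nonpos_iff_eq_zero.1 (ENNReal.le_of_forall_pos_le_add fun ε hε _ => ?_)
  have := h ε⁻¹ (inv_pos.2 hε)
  rwa [ENNReal.coe_inv hε.ne', one_div, inv_inv, ← zero_add (ε : ℝ≥0∞)] at this

lemma ghlpDist_self (X : DistanceMeasureSpace.{u}) : ghlpDist X X = 0 := by
  refine eq_zero_of_forall_le_inv fun L hL => ?_
  have hid : IsLIsometricEpsEmbedding X L 0 (id : X → X) :=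
    ⟨measurable_id, ∅, by simp, fun _ _ _ _ _ => rfl⟩
  simpa using ghlpDist_le hL hid hid

/-- All spaces of measure zero, including the empty one, are at distance zero from one another. -/
lemma ghlpDist_eq_zero_of_measure_eq_zero {X Y : DistanceMeasureSpace.{u}} (hX : X.μ = 0)
    (hY : Y.μ = 0) : ghlpDist X Y = 0 := by
  refine eq_zero_of_forall_le_inv fun L hL => ?_
  -- The whole space may be exceptional, so a constant map to a point is admissible.
  let _ : MeasurableSpace PUnit.{u + 1} := borel _
  have : BorelSpace PUnit.{u + 1} := ⟨rfl⟩
  have h : ∀ W : DistanceMeasureSpace.{u}, W.μ = 0 →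
      IsLIsometricEpsEmbedding W L 0 (fun _ : W => PUnit.unit.{u + 1}) := fun W hW =>
    ⟨measurable_const, univ, by simp [hW], by simp [IsLIsometricOn]⟩
  simpa [hX, hY] using ghlpDist_le hL (h X hX) (h Y hY)

lemma IsLIsometricEpsEmbedding.comp_truncation {X : DistanceMeasureSpace.{u}} {Z Z' : Type u}
    [EMetricSpace Z] [MeasurableSpace Z] [BorelSpace Z] [EMetricSpace Z'] [MeasurableSpace Z']
    [BorelSpace Z'] {L L' ε ε' : ℝ≥0} {f : X → Z} (hf : IsLIsometricEpsEmbedding X L ε f)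
    (hL : L' ≤ L) (hε : ε ≤ ε') {i : Z → Z'}
    (hi : ∀ x y, edist (i x) (i y) = min (edist x y) L') :
    IsLIsometricEpsEmbedding X L' ε' (i ∘ f) := by
  obtain ⟨hfm, E, hE, hfE⟩ := hf
  refine ⟨(lipschitzWith_one_of_edist_eq_min hi).continuous.measurable.comp hfm, E,
    hE.trans (by exact_mod_cast hε), isLIsometricOn_iff.2 fun x hx y hy => ?_⟩
  have h := congrArg (fun r => min r (L' : ℝ≥0∞)) (isLIsometricOn_iff.1 hfE x hx y hy)
  have hL' : (L' : ℝ≥0∞) ≤ L := by exact_mod_cast hL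
  simp only [min_assoc, min_eq_right hL'] at h
  simpa [hi, min_assoc] using h

/-- The weak triangle inequality for the distance `d_ρ`. -/
lemma ghlpDist_le_two_mul_add {X Y W : DistanceMeasureSpace.{u}} {a b : ℝ≥0∞}
    (hXY : ghlpDist X Y < a) (hYW : ghlpDist Y W < b) : ghlpDist X W ≤ 2 * (a + b) := by
  obtain ⟨_, ⟨Z₁, _, _, _, L₁, ε₁, f, g, hL₁, hf, hg, rfl⟩, h₁⟩ := sInf_lt_iff.1 hXY
  obtain ⟨_, ⟨Z₂, _, _, _, L₂, ε₂, g', h, hL₂, hg', hh, rfl⟩, h₂⟩ := sInf_lt_iff.1 hYW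
  obtain ⟨hgm, E, hE, hgE⟩ := id hg
  obtain ⟨hgm', E', hE', hgE'⟩ := id hg'
  set L := min L₁ L₂ with hLdef
  have hL : 0 < L := lt_min hL₁ hL₂
  -- Glueing needs a positive gap; `1 / L₁` is already part of the cost, and the factor `2` absorbs
  -- the second copy.
  have hδ : 0 < L₁⁻¹ := inv_pos.2 hL₁
  have trunc : ∀ {Z : Type u} [EMetricSpace Z] {K : ℝ≥0} {u : Y → Z} {s : Set Y}, L ≤ K →
      IsLIsometricOn K u s → ∀ x ∈ s, ∀ y ∈ s,
        min (edist (u x) (u y)) (L : ℝ≥0∞) = min (edist x y) L := by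
    intro Z _ K u s hK hu x hx y hy
    have h := congrArg (fun r => min r (L : ℝ≥0∞)) (isLIsometricOn_iff.1 hu x hx y hy)
    have hK' : (L : ℝ≥0∞) ≤ K := by exact_mod_cast hK
    simpa only [min_assoc, min_eq_right hK'] using h
  -- Off both exceptional sets the two images of `Y` have the same truncated distances, so they can
  -- be glued together.
  have key : ∀ p q : ((E ∪ E')ᶜ : Set Y),
      min (edist (g p) (g q)) (L : ℝ≥0∞) = min (edist (g' p) (g' q)) L := by
    rintro ⟨p, hp⟩ ⟨q, hq⟩
    rw [compl_union] at hp hq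
    rw [trunc (min_le_left _ _) hgE p hp.1 q hq.1, trunc (min_le_right _ _) hgE' p hp.2 q hq.2]
  obtain ⟨Z, _, i, j, hi, hj, hij⟩ := exists_truncated_glueing Z₁ Z₂ hL hδ
    (fun p : ((E ∪ E')ᶜ : Set Y) => g p) (fun p => g' p)
    (fun p q => (key p q).le.trans le_self_add) (fun p q => (key p q).ge.trans le_self_add)
  let _ : MeasurableSpace Z := borel Z
  have : BorelSpace Z := ⟨rfl⟩
  have hi1 := lipschitzWith_one_of_edist_eq_min hi
  have hj1 := lipschitzWith_one_of_edist_eq_min hj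
  have him : Measurable i := hi1.continuous.measurable
  have hjm : Measurable j := hj1.continuous.measurable
  refine (ghlpDist_le (ε := ε₁ + ε₂) hL
    (hf.comp_truncation (min_le_left _ _) le_self_add hi)
    (hh.comp_truncation (min_le_right _ _) le_add_self hj)).trans ?_
  have hmid : levyProkhorovEDist (Y.μ.map (i ∘ g)) (Y.μ.map (j ∘ g')) ≤
      (ε₁ + ε₂ : ℝ≥0∞) + (L₁⁻¹ : ℝ≥0) := by
    refine levyProkhorovEDist_map_map_le Y.μ (him.comp hgm) (hjm.comp hgm') (s := E ∪ E')
      ((measure_union_le _ _).trans ((add_le_add hE hE').trans le_self_add)) fun y hy => ?_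
    exact (hij ⟨y, hy⟩).trans le_add_self
  have hleft : levyProkhorovEDist (X.μ.map (i ∘ f)) (Y.μ.map (i ∘ g)) ≤
      levyProkhorovEDist (X.μ.map f) (Y.μ.map g) := by
    rw [← Measure.map_map him hf.1, ← Measure.map_map him hgm]
    exact levyProkhorovEDist_map_le_of_lipschitz hi1 _ _
  have hright : levyProkhorovEDist (Y.μ.map (j ∘ g')) (W.μ.map (j ∘ h)) ≤
      levyProkhorovEDist (Y.μ.map g') (W.μ.map h) := by
    rw [← Measure.map_map hjm hgm', ← Measure.map_map hjm hh.1]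
    exact levyProkhorovEDist_map_le_of_lipschitz hj1 _ _
  have hLinv : 1 / (L : ℝ≥0∞) ≤ 1 / L₁ + 1 / L₂ := by
    rcases min_choice L₁ L₂ with h | h <;> rw [hLdef, h]
    · exact le_self_add
    · exact le_add_self
  have hinv : ((L₁⁻¹ : ℝ≥0) : ℝ≥0∞) = 1 / L₁ := by
    rw [ENNReal.coe_inv hL₁.ne', one_div]
  rw [hinv] at hmid
  calc _ ≤ (levyProkhorovEDist (X.μ.map f) (Y.μ.map g) + ((ε₁ + ε₂ : ℝ≥0∞) + 1 / L₁) +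
          levyProkhorovEDist (Y.μ.map g') (W.μ.map h)) + (1 / L₁ + 1 / L₂) + (ε₁ + ε₂) := by
        push_cast
        gcongr
        exact (levyProkhorovEDist_triangle _ _ _).trans (add_le_add
          ((levyProkhorovEDist_triangle _ _ _).trans (add_le_add hleft hmid)) hright)
    _ ≤ 2 * ((levyProkhorovEDist (X.μ.map f) (Y.μ.map g) + 1 / L₁ + ε₁) +
          (levyProkhorovEDist (Y.μ.map g') (W.μ.map h) + 1 / L₂ + ε₂)) := by
        generalize levyProkhorovEDist (X.μ.map f) (Y.μ.map g) = x
        generalize levyProkhorovEDist (Y.μ.map g') (W.μ.map h) = y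
        calc _ ≤ (x + (ε₁ + ε₂ + 1 / L₁) + y + (1 / L₁ + 1 / L₂) + (ε₁ + ε₂) : ℝ≥0∞)
                + (x + y + 1 / L₂) := le_self_add
          _ = _ := by ring
    _ ≤ 2 * (a + b) := by gcongr

end GHLP

/-! ### Compactness from a weak triangle inequality. -/

section WeakMetric

variable {T : Type*} {d : T → T → ℝ≥0∞}

/-- For a distance with a weak triangle inequality, sequential precompactness implies total
boundedness. -/
lemma exists_finite_net_of_seq_precompact (hcomm : ∀ x y, d x y = d y x)
    (htri : ∀ ε > 0, ∃ δ > 0, ∀ x y z, d x y < δ → d y z < δ → d x z < ε) {s : Set T}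
    (hs : ∀ x : ℕ → T, (∀ n, x n ∈ s) → ∃ (y : T) (φ : ℕ → ℕ), StrictMono φ ∧
      Tendsto (fun n => d (x (φ n)) y) atTop (𝓝 0)) {ε : ℝ≥0∞} (hε : 0 < ε) :
    ∃ F ⊆ s, F.Finite ∧ ∀ x ∈ s, ∃ y ∈ F, d x y < ε := by
  by_contra! hcon
  -- Without a finite net there is an `ε`-separated sequence in `s`.
  obtain ⟨x, hmem, hsep⟩ := exists_seq_of_forall_finset_exists (· ∈ s) (fun y x => ε ≤ d x y)
    fun F hF => hcon F hF F.finite_toSet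
  obtain ⟨y, φ, hφ, hlim⟩ := hs x hmem
  obtain ⟨δ, hδ, h⟩ := htri ε hε
  obtain ⟨n, hn⟩ := eventually_atTop.1 (hlim.eventually_lt_const hδ)
  refine (hsep _ _ (hφ n.lt_succ_self)).not_gt (h _ y _ (hn _ n.le_succ) ?_)
  rw [hcomm]
  exact hn n le_rfl

/-- For a distance with a weak triangle inequality, sequentially precompact sets have compact
closure. -/
lemma isCompact_closure_of_seq_precompact [TopologicalSpace T]
    (hopen : ∀ U : Set T, IsOpen U ↔ ∀ x ∈ U, ∃ ε > 0, ∀ y, d x y < ε → y ∈ U)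
    (hself : ∀ x, d x x = 0) (hcomm : ∀ x y, d x y = d y x)
    (htri : ∀ ε > 0, ∃ δ > 0, ∀ x y z, d x y < δ → d y z < δ → d x z < ε) {s : Set T}
    (hs : ∀ x : ℕ → T, (∀ n, x n ∈ s) → ∃ (y : T) (φ : ℕ → ℕ), StrictMono φ ∧
      Tendsto (fun n => d (x (φ n)) y) atTop (𝓝 0)) : IsCompact (closure s) := by
  have hanti : ∀ a b : ℝ≥0∞, a ≤ b → {p : T × T | d p.1 p.2 < a} ⊆ {p | d p.1 p.2 < b} :=
    fun a b hab p hp => lt_of_lt_of_le hp hab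
  have hne : (Ioi (0 : ℝ≥0∞)).Nonempty := ⟨1, mem_Ioi.2 one_pos⟩
  have hbasis : (⨅ ε ∈ Ioi (0 : ℝ≥0∞), 𝓟 {p : T × T | d p.1 p.2 < ε}).HasBasis
      (fun ε => ε ∈ Ioi (0 : ℝ≥0∞)) fun ε => {p : T × T | d p.1 p.2 < ε} := by
    refine hasBasis_biInf_principal (fun a ha b hb => ⟨min a b, mem_Ioi.2 (lt_min ha hb),
      hanti _ _ (min_le_left _ _), hanti _ _ (min_le_right _ _)⟩) hne
  -- The weak triangle inequality is exactly the composition axiom of a uniformity.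
  let C : UniformSpace.Core T :=
    { uniformity := ⨅ ε ∈ Ioi (0 : ℝ≥0∞), 𝓟 {p : T × T | d p.1 p.2 < ε}
      refl := by
        refine le_iInf₂ fun ε hε => ?_
        rw [principal_mono]
        rintro ⟨x, y⟩ hxy
        obtain rfl : x = y := hxy
        simpa [hself] using hε
      symm := by
        refine (hbasis.tendsto_iff hbasis).2 fun ε hε => ⟨ε, hε, fun p hp => ?_⟩
        simpa [hcomm p.2 p.1] using hp
      comp := by
        refine (hbasis.lift' (monotone_id.relComp monotone_id)).le_basis_iff hbasis |>.2 fun ε hε => ?_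
        obtain ⟨δ, hδ, h⟩ := htri ε hε
        refine ⟨δ, hδ, ?_⟩
        rintro ⟨x, z⟩ ⟨y, hxy, hyz⟩
        exact h x y z hxy hyz }
  let u : UniformSpace T := UniformSpace.ofCore C
  have hu : (@uniformity T u).HasBasis (fun ε => ε ∈ Ioi (0 : ℝ≥0∞)) fun ε => {p : T × T | d p.1 p.2 < ε} :=
    hbasis
  have htop : ‹TopologicalSpace T› = u.toTopologicalSpace := by
    ext U
    rw [hopen, isOpen_uniformity]
    refine forall₂_congr fun x _ => ?_
    rw [hu.mem_iff]
    refine exists_congr fun ε => and_congr Iff.rfl ⟨?_, fun h y hy => h (a := (x, y)) hy rfl⟩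
    rintro h ⟨x', y⟩ hxy rfl
    exact h y hxy
  subst htop
  have hnhds : ∀ x, ((𝓝 x).HasBasis (fun ε => ε ∈ Ioi (0 : ℝ≥0∞)) fun ε => {y | d x y < ε}) :=
    fun x => nhds_basis_uniformity' hu
  -- Countable generation makes compactness equivalent to sequential compactness.
  have hcount : (uniformity T).IsCountablyGenerated := by
    obtain ⟨a, -, ha, hlim⟩ := exists_seq_strictAnti_tendsto' (ENNReal.zero_lt_top)
    refine HasBasis.isCountablyGenerated (p := fun _ : ℕ => True)
      (s := fun n => {p : T × T | d p.1 p.2 < a n}) (hu.to_hasBasis ?_ ?_)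
    · intro ε hε
      obtain ⟨n, hn⟩ := (hlim.eventually_lt_const hε).exists
      exact ⟨n, trivial, hanti _ _ hn.le⟩
    · exact fun n _ => ⟨a n, (ha n).1, subset_rfl⟩
  rw [_root_.isCompact_iff_isSeqCompact]
  intro x hx
  obtain ⟨a, -, ha, hlim⟩ := exists_seq_strictAnti_tendsto' (ENNReal.zero_lt_top)
  -- Points of the closure are replaced by points of `s` at distances tending to zero.
  have happrox : ∀ n, ∃ z ∈ s, d (x n) z < a n := fun n => by
    obtain ⟨z, hz, hzs⟩ := (mem_closure_iff_nhds_basis (hnhds (x n))).1 (hx n) (a n) (ha n).1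
    exact ⟨z, hz, hzs⟩
  choose z hzs hxz using happrox
  obtain ⟨y, φ, hφ, hzy⟩ := hs z hzs
  have hxy : Tendsto (x ∘ φ) atTop (𝓝 y) := by
    refine (hnhds y).tendsto_right_iff.2 fun ε hε => ?_
    obtain ⟨δ, hδ, h⟩ := htri ε hε
    filter_upwards [hzy.eventually_lt_const hδ,
      (hlim.comp hφ.tendsto_atTop).eventually_lt_const hδ] with n h1 h2
    rw [hcomm]
    exact h _ _ _ ((hxz _).trans h2) h1
  exact ⟨y, isClosed_closure.mem_of_tendsto hxy (Eventually.of_forall fun n => hx _), φ, hφ, hxy⟩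

end WeakMetric

/-! ### Limits of measures and of distance matrices. -/

section Limits

/-- On a compact space, a bounded family of finite measures has a limit along an ultrafilter, in
the sense of convergence of the mass of clopen sets. -/
lemma exists_measure_tendsto_of_isClopen {ι K : Type*} [TopologicalSpace K] [CompactSpace K]
    [T2Space K] [MeasurableSpace K] [BorelSpace K] (U : Ultrafilter ι) (q : ι → Measure K)
    {M : ℝ≥0} (hq : ∀ n, q n univ ≤ M) :
    ∃ ν : Measure K, IsFiniteMeasure ν ∧
      ∀ C, IsClopen C → Tendsto (fun n => q n C) U (𝓝 (ν C)) := by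
  have hfin : ∀ n, IsFiniteMeasure (q n) := fun n => ⟨(hq n).trans_lt ENNReal.coe_lt_top⟩
  let Q : ι → FiniteMeasure K := fun n => ⟨q n, hfin n⟩
  obtain ⟨ν, -, hν⟩ :=
    (isCompact_setOfPred_finiteMeasure_le_of_compactSpace K M).ultrafilter_le_nhds (U.map Q) (by
      refine le_principal_iff.2 (Eventually.of_forall (f := (U : Filter ι)) fun n => ?_)
      have := hq n
      rw [mem_ofPred_eq, ← ENNReal.coe_le_coe, FiniteMeasure.ennreal_mass]
      exact this)
  refine ⟨ν, inferInstance, fun C hC => ?_⟩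
  have hlim : Tendsto Q U (𝓝 ν) := hν
  -- The indicator of a clopen set is a continuous test function.
  let g : BoundedContinuousFunction K ℝ≥0 := BoundedContinuousFunction.mkOfCompact
    ⟨C.indicator 1, hC.continuous_indicator continuous_one⟩
  have hg : ∀ μ : Measure K, ∫⁻ x, g x ∂μ = μ C := by
    intro μ
    rw [← lintegral_indicator_one hC.isOpen.measurableSet]
    refine lintegral_congr fun x => ?_
    by_cases hx : x ∈ C <;> simp [g, hx]
  have := FiniteMeasure.tendsto_iff_forall_lintegral_tendsto.1 hlim g
  simp only [hg] at this
  exact this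

/-- Every countable distance matrix is realised in a complete separable distance space. -/
lemma exists_complete_separable_realization {ι : Type} [Countable ι] (D : ι → ι → ℝ≥0∞)
    (hself : ∀ a, D a a = 0) (hcomm : ∀ a b, D a b = D b a)
    (htri : ∀ a b c, D a c ≤ D a b + D b c) :
    ∃ (Y : Type u) (_ : EMetricSpace Y) (y : ι → Y), CompleteSpace Y ∧
      TopologicalSpace.SeparableSpace Y ∧ ∀ a b, edist (y a) (y b) = D a b := by
  let F := UniformFun (ULift.{u} (ι × ℕ)) ℝ
  -- A Kuratowski embedding whose coordinates are truncated at every `m`: each is real, and their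
  -- supremum recovers infinite distances.
  let f : ι → F := fun a => UniformFun.ofFun fun c => (min (D a c.down.1) c.down.2).toReal
  have hf : ∀ a b, edist (f a) (f b) = D a b := by
    intro a b
    have hfin : ∀ (r : ℝ≥0∞) (m : ℕ), min r m ≠ ∞ := fun r m =>
      ((min_le_right _ _).trans_lt (ENNReal.natCast_lt_top m)).ne
    apply le_antisymm
    · refine UniformFun.edist_le.2 fun c => ?_
      obtain hD | hD := eq_or_ne (D a b) ∞
      · simp [hD]
      have hle : ∀ a b : ι, D a b ≠ ∞ → (min (D a c.down.1) c.down.2).toReal ≤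
          (min (D b c.down.1) c.down.2).toReal + (D a b).toReal := by
        intro a b hD
        rw [← ENNReal.toReal_add (hfin _ _) hD]
        refine ENNReal.toReal_mono (ENNReal.add_ne_top.2 ⟨hfin _ _, hD⟩) ?_
        rcases le_total (D b c.down.1) c.down.2 with h | h
        · rw [min_eq_left h, add_comm]
          exact (min_le_left _ _).trans (htri _ _ _)
        · rw [min_eq_right h]
          exact (min_le_right _ _).trans le_self_add
      rw [edist_dist, ← ENNReal.ofReal_toReal hD]
      refine ENNReal.ofReal_le_ofReal (abs_le.2 ⟨?_, ?_⟩)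
      · have := hle b a (by rwa [hcomm])
        rw [hcomm b a] at this
        change -(D a b).toReal ≤ (min (D a c.down.1) c.down.2).toReal -
          (min (D b c.down.1) c.down.2).toReal
        linarith
      · have := hle a b hD
        change (min (D a c.down.1) c.down.2).toReal -
          (min (D b c.down.1) c.down.2).toReal ≤ (D a b).toReal
        linarith
    · refine le_of_forall_lt fun r hr => ?_
      obtain ⟨m, hm⟩ := ENNReal.exists_nat_gt hr.ne_top
      refine (lt_min hr hm).trans_le ?_
      refine le_trans (le_of_eq ?_) (UniformFun.edist_eval_le (x := ULift.up (b, m)))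
      change _ = edist (min (D a b) m).toReal (min (D b b) m).toReal
      rw [hself, min_eq_left zero_le, ENNReal.toReal_zero, edist_dist, Real.dist_0_eq_abs,
        abs_of_nonneg ENNReal.toReal_nonneg, ENNReal.ofReal_toReal (hfin _ _)]
  refine ⟨closure (range f), inferInstance, fun a => ⟨f a, subset_closure (mem_range_self a)⟩,
    isClosed_closure.isComplete.completeSpace_coe, ?_, hf⟩
  exact ((countable_range f).isSeparable.closure).separableSpace

end Limits
-- Discretization and reconstruction of a limit point.
section Discretization

/-- A nonempty space that is nearly covered by few small balls is discretized by the index of the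
first ball containing a point; the last index stands for no ball. -/
lemma exists_measurable_discretization (X : DistanceMeasureSpace.{u}) [Nonempty X] {N : ℕ} {ε : ℝ}
    {S : Finset X} (hcard : S.card ≤ N)
    (hS : X.μ (Metric.thickening ε (S : Set X))ᶜ ≤ ENNReal.ofReal ε) :
    ∃ (x : Fin (N + 1) → X) (p : X → Fin (N + 1)), Measurable p ∧
      X.μ {z | p z = Fin.last N} ≤ ENNReal.ofReal ε ∧
      ∀ z, p z ≠ Fin.last N → edist z (x (p z)) ≤ ENNReal.ofReal ε := by
  classical
  obtain ⟨x, hx⟩ : ∃ x : ℕ → X, ∀ z ∈ S, ∃ i < N, x i = z := by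
    refine ⟨fun i => if h : i < S.card then S.equivFin.symm ⟨i, h⟩ else Classical.arbitrary _,
      fun z hz => ⟨S.equivFin ⟨z, hz⟩, (Fin.is_lt _).trans_le hcard, ?_⟩⟩
    simp
  -- The least such `i` is the index; the alternative `i = N` makes the search terminate.
  have hex : ∀ z, ∃ i, edist z (x i) < ENNReal.ofReal ε ∨ i = N := fun z => ⟨N, Or.inr rfl⟩
  have hlt : ∀ z, Nat.find (hex z) < N + 1 := fun z =>
    Nat.lt_succ_of_le (Nat.find_min' _ (Or.inr rfl))
  have hmeas : Measurable fun z => Nat.find (hex z) := by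
    refine measurable_find hex fun i => ?_
    by_cases hi : i = N
    · simp [hi]
    · simp only [hi, or_false]
      exact (Metric.isOpen_eball (x := x i) (ε := ENNReal.ofReal ε)).measurableSet
  refine ⟨fun i => x i, fun z => ⟨Nat.find (hex z), hlt z⟩, ?_, ?_, ?_⟩
  · refine measurable_to_countable' fun i => ?_
    convert! hmeas (measurableSet_singleton (i : ℕ)) using 1
    ext z
    simp [Fin.ext_iff]
  · refine (measure_mono fun z hz => ?_).trans hS
    simp only [mem_ofPred_eq, Fin.ext_iff, Fin.val_last] at hz
    intro hz'
    obtain ⟨w, hw, hzw⟩ := (Metric.mem_thickening_iff_exists_edist_lt _ _).1 hz'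
    obtain ⟨i, hi, rfl⟩ := hx w hw
    exact hi.not_ge (hz ▸ Nat.find_min' (hex z) (Or.inl hzw))
  · intro z hz
    rcases Nat.find_spec (hex z) with h | h
    · exact h.le
    · exact absurd (Fin.ext h) hz

/-- A comparison of a space with the law of a random point in another one, through discretizations
indexed by the same finite set. -/
lemma ghlpDist_le_of_discretization {X Y : DistanceMeasureSpace.{u}} {K I : Type*}
    [MeasurableSpace K] [MeasurableSpace I] [DiscreteMeasurableSpace I] (ν : Measure K) {T : K → Y}
    (hT : Measurable T) (hYμ : Y.μ = ν.map T) {p : X → I} (hp : Measurable p) {p' : K → I}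
    (hp' : Measurable p') (x : I → X) (y : I → Y) {a b : ℝ≥0∞} {δ L : ℝ≥0} (hδ : 0 < δ)
    (hL : 0 < L) {s : Set X} (hs : X.μ s ≤ a) (hsx : ∀ z ∉ s, edist z (x (p z)) ≤ a)
    {t : Set K} (ht : ν t ≤ b) (hty : ∀ κ ∉ t, edist (y (p' κ)) (T κ) ≤ b)
    (h : ∀ i j, min (edist (x i) (x j)) (L : ℝ≥0∞) ≤ min (edist (y i) (y j)) L + 2 * δ)
    (h' : ∀ i j, min (edist (y i) (y j)) (L : ℝ≥0∞) ≤ min (edist (x i) (x j)) L + 2 * δ)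
    (hmass : ∀ A : Set I, X.μ (p ⁻¹' A) ≤ ν (p' ⁻¹' A) + δ ∧ ν (p' ⁻¹' A) ≤ X.μ (p ⁻¹' A) + δ) :
    ghlpDist X Y ≤ a + δ + δ + b + 1 / L := by
  obtain ⟨Z, _, i, j, hi, hj, hij⟩ := exists_truncated_glueing X Y hL hδ x y h h'
  let _ : MeasurableSpace Z := borel Z
  have : BorelSpace Z := ⟨rfl⟩
  have hi1 := lipschitzWith_one_of_edist_eq_min hi
  have hj1 := lipschitzWith_one_of_edist_eq_min hj
  have him : Measurable i := hi1.continuous.measurable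
  have hjm : Measurable j := hj1.continuous.measurable
  have emb : ∀ {W : DistanceMeasureSpace.{u}} {k : W → Z},
      (∀ v w, edist (k v) (k w) = min (edist v w) L) → IsLIsometricEpsEmbedding W L 0 k := by
    intro W k hk
    refine ⟨(lipschitzWith_one_of_edist_eq_min hk).continuous.measurable, ∅, by simp,
      isLIsometricOn_iff.2 fun v _ w _ => ?_⟩
    rw [hk, min_assoc, min_self]
  have hxp : Measurable fun z => i (x (p z)) := (Measurable.of_discrete (f := i ∘ x)).comp hp
  have hyp : Measurable fun z => j (y (p z)) := (Measurable.of_discrete (f := j ∘ y)).comp hp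
  have hyp' : Measurable fun κ => j (y (p' κ)) := (Measurable.of_discrete (f := j ∘ y)).comp hp'
  -- Four legs: to the nearby centre in `X`, across the glueing, from the index law of `X` to that
  -- of `ν`, and to `T` in `Y`.
  have h1 : levyProkhorovEDist (X.μ.map i) (X.μ.map fun z => i (x (p z))) ≤ a :=
    levyProkhorovEDist_map_map_le X.μ him hxp hs fun z hz =>
      (by simpa using hi1 z (x (p z)) : edist (i z) _ ≤ _).trans (hsx z hz)
  have h2 : levyProkhorovEDist (X.μ.map fun z => i (x (p z))) (X.μ.map fun z => j (y (p z))) ≤ δ :=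
    levyProkhorovEDist_map_map_le X.μ hxp hyp (s := ∅) (by simp) fun z _ => hij _
  have h3 : levyProkhorovEDist (X.μ.map fun z => j (y (p z))) (ν.map fun κ => j (y (p' κ))) ≤ δ :=
    levyProkhorovEDist_le_of_forall_measure_le fun B hB => by
      rw [Measure.map_apply hyp hB, Measure.map_apply hyp' hB]
      exact hmass ((j ∘ y) ⁻¹' B)
  have h4 : levyProkhorovEDist (ν.map fun κ => j (y (p' κ))) (Y.μ.map j) ≤ b := by
    rw [hYμ, Measure.map_map hjm hT]
    exact levyProkhorovEDist_map_map_le ν hyp' (hjm.comp hT) ht fun κ hκ =>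
      (by simpa using hj1 (y (p' κ)) (T κ) : edist (j _) ((j ∘ T) κ) ≤ _).trans (hty κ hκ)
  have := ghlpDist_le hL (emb hi) (emb hj)
  rw [ENNReal.coe_zero, add_zero] at this
  refine this.trans ?_
  gcongr
  refine (levyProkhorovEDist_triangle _ _ _).trans (add_le_add
    ((levyProkhorovEDist_triangle _ _ _).trans (add_le_add
    ((levyProkhorovEDist_triangle _ _ _).trans (add_le_add h1 h2)) h3)) h4)

/-- A random sequence of points whose consecutive distances are geometrically small converges, with
an explicit rate in probability. The index `Fin.last` stands for a failure. -/
lemma exists_measurable_limit_of_indices {N : ℕ → ℕ} (ν : Measure (∀ k, Fin (N k + 1)))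
    {Y : Type*} [EMetricSpace Y] [CompleteSpace Y] [MeasurableSpace Y] [BorelSpace Y]
    (y : ∀ k, Fin (N k + 1) → Y)
    (hlast : ∀ k, ν {κ | κ k = Fin.last (N k)} ≤ (2 : ℝ≥0∞)⁻¹ ^ k)
    (hdist : ∀ k i j, i ≠ Fin.last (N k) → j ≠ Fin.last (N (k + 1)) →
      ν {κ | κ k = i ∧ κ (k + 1) = j} ≠ 0 → edist (y k i) (y (k + 1) j) ≤ 2 * (2 : ℝ≥0∞)⁻¹ ^ k) :
    ∃ T : (∀ k, Fin (N k + 1)) → Y, Measurable T ∧ ∀ k, ∃ t : Set (∀ k, Fin (N k + 1)),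
      ν t ≤ 4 * (2 : ℝ≥0∞)⁻¹ ^ k ∧ ∀ κ ∉ t, edist (y k (κ k)) (T κ) ≤ 4 * (2 : ℝ≥0∞)⁻¹ ^ k := by
  -- The countably many null events on index pairs are discarded, leaving the bound almost surely.
  have hae : ∀ᵐ κ ∂ν, ∀ k, κ k ≠ Fin.last (N k) → κ (k + 1) ≠ Fin.last (N (k + 1)) →
      edist (y k (κ k)) (y (k + 1) (κ (k + 1))) ≤ 2 * (2 : ℝ≥0∞)⁻¹ ^ k := by
    refine ae_all_iff.2 fun k => ?_
    have : ∀ᵐ κ ∂ν, ∀ i j, ν {κ | κ k = i ∧ κ (k + 1) = j} = 0 → ¬ (κ k = i ∧ κ (k + 1) = j) := by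
      refine ae_all_iff.2 fun i => ae_all_iff.2 fun j => ?_
      by_cases h : ν {κ | κ k = i ∧ κ (k + 1) = j} = 0
      · filter_upwards [measure_eq_zero_iff_ae_notMem.1 h] with κ hκ _ using hκ
      · exact Eventually.of_forall fun κ h' => absurd h' h
    filter_upwards [this] with κ hκ h1 h2
    exact hdist k _ _ h1 h2 fun h0 => hκ _ _ h0 ⟨rfl, rfl⟩
  have hsum : ∀ k, ∑' l, (2 : ℝ≥0∞)⁻¹ ^ (k + l) = 2 * 2⁻¹ ^ k := by
    intro k
    simp_rw [pow_add]
    rw [ENNReal.tsum_mul_left, ENNReal.tsum_geometric, ENNReal.one_sub_inv_two, inv_inv, mul_comm]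
  -- Borel–Cantelli: almost surely only finitely many indices fail.
  have hev : ∀ᵐ κ ∂ν, ∀ᶠ k in atTop, κ k ≠ Fin.last (N k) := by
    refine ae_eventually_notMem (s := fun k => {κ : ∀ k, Fin (N k + 1) | κ k = Fin.last (N k)}) ?_
    refine ((ENNReal.tsum_le_tsum hlast).trans_lt ?_).ne
    have := hsum 0
    simp only [zero_add] at this
    simp [this]
  have hrate : ∀ (κ : ∀ k, Fin (N k + 1)) (k : ℕ), (∀ k, κ k ≠ Fin.last (N k) →
      κ (k + 1) ≠ Fin.last (N (k + 1)) →
      edist (y k (κ k)) (y (k + 1) (κ (k + 1))) ≤ 2 * (2 : ℝ≥0∞)⁻¹ ^ k) →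
      (∀ l, κ (k + l) ≠ Fin.last (N (k + l))) → ∀ n,
      edist (y (k + n) (κ (k + n))) (y (k + (n + 1)) (κ (k + (n + 1)))) ≤
        2 * (2 : ℝ≥0∞)⁻¹ ^ k / 2 ^ n := by
    intro κ k h1 h2 n
    refine (h1 (k + n) (h2 n) (h2 (n + 1))).trans (le_of_eq ?_)
    rw [pow_add, div_eq_mul_inv, ENNReal.inv_pow, mul_assoc]
  have hC : ∀ k : ℕ, 2 * (2 : ℝ≥0∞)⁻¹ ^ k ≠ ∞ := fun k =>
    ENNReal.mul_ne_top (by simp) (ENNReal.pow_ne_top (by simp))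
  have hshift : ∀ (κ : ∀ k, Fin (N k + 1)) (k n : ℕ),
      y (n + k) (κ (n + k)) = y (k + n) (κ (k + n)) := fun κ k n => by rw [add_comm]
  have hlimex : ∀ᵐ κ ∂ν, ∃ l, Tendsto (fun k => y k (κ k)) atTop (𝓝 l) := by
    filter_upwards [hae, hev] with κ h1 h2
    obtain ⟨k, hk⟩ := eventually_atTop.1 h2
    obtain ⟨l, hl⟩ := cauchySeq_tendsto_of_complete (cauchySeq_of_edist_le_geometric_two _ (hC k)
      (hrate κ k h1 fun l => hk _ (Nat.le_add_right _ _)))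
    refine ⟨l, (tendsto_add_atTop_iff_nat k).1 ?_⟩
    simpa only [hshift] using hl
  obtain ⟨T, hT, hlim⟩ := measurable_limit_of_tendsto_metrizable_ae (μ := ν) (L := atTop)
    (f := fun k κ => y k (κ k))
    (fun k => ((Measurable.of_discrete (f := y k)).comp (measurable_pi_apply k)).aemeasurable) hlimex
  refine ⟨T, hT, fun k => ?_⟩
  have hnull := hae.and hlim
  -- Failures from `k` on have mass at most `2 * 2⁻ᵏ`; off them the steps `2 * 2⁻ᵏ / 2ⁿ` sum to `4 *
  -- 2⁻ᵏ`.
  refine ⟨(⋃ l, {κ | κ (k + l) = Fin.last (N (k + l))}) ∪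
    {κ | ¬ ((∀ k, κ k ≠ Fin.last (N k) → κ (k + 1) ≠ Fin.last (N (k + 1)) →
      edist (y k (κ k)) (y (k + 1) (κ (k + 1))) ≤ 2 * (2 : ℝ≥0∞)⁻¹ ^ k) ∧
      Tendsto (fun k => y k (κ k)) atTop (𝓝 (T κ)))}, ?_, fun κ hκ => ?_⟩
  · refine (measure_union_le _ _).trans ?_
    rw [ae_iff.1 hnull, add_zero]
    refine (measure_iUnion_le _).trans ((ENNReal.tsum_le_tsum fun l => hlast _).trans ?_)
    rw [hsum]
    gcongr
    norm_num
  · rw [mem_union, not_or, mem_iUnion, not_exists, mem_ofPred_eq, not_not] at hκ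
    obtain ⟨h1, h2, h3⟩ := hκ
    have h3' : Tendsto (fun n => y (k + n) (κ (k + n))) atTop (𝓝 (T κ)) := by
      have := (tendsto_add_atTop_iff_nat (f := fun k => y k (κ k)) k).2 h3
      simpa only [hshift] using this
    have := edist_le_of_edist_le_geometric_two_of_tendsto₀ _ (hrate κ k h2 h1) h3'
    rw [← mul_assoc] at this
    norm_num at this
    exact this

end Discretization

/-! ### Construction of the limit space and conclusion. -/

section Precompactness

lemma ENNReal.eventually_le_add_of_tendsto {ι : Type*} {l : Filter ι} {f : ι → ℝ≥0∞} {a : ℝ≥0∞}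
    (ha : a ≠ ∞) (h : Tendsto f l (𝓝 a)) {δ : ℝ≥0∞} (hδ : 0 < δ) :
    ∀ᶠ n in l, f n ≤ a + δ ∧ a ≤ f n + δ := by
  filter_upwards [(ENNReal.tendsto_nhds ha).1 h δ hδ] with n hn
  exact ⟨hn.2, tsub_le_iff_right.1 hn.1⟩

/-- Uniformly nearly finite sequences of nonempty spaces have convergent subsequences. -/
lemma exists_subseq_tendsto_of_nonempty (X : ℕ → DistanceMeasureSpace.{u})
    (hne : ∀ n, Nonempty (X n)) (M : ℝ≥0) (hM : ∀ n, (X n).μ univ ≤ M)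
    (hN : ∀ ε : ℝ, 0 < ε → ∃ N : ℕ, ∀ n, ∃ S : Finset (X n),
      S.card ≤ N ∧ (X n).μ (Metric.thickening ε (S : Set (X n)))ᶜ ≤ ENNReal.ofReal ε) :
    ∃ (Y : CompleteSeparableDMS.{u}) (φ : ℕ → ℕ), StrictMono φ ∧
      Tendsto (fun n => ghlpDist (X (φ n)) Y.1) atTop (𝓝 0) := by
  choose N S hcard hS using fun k : ℕ => hN ((1 / 2) ^ k) (by positivity)
  choose x p hp hlast hclose using fun n k =>
    exists_measurable_discretization (X n) (hcard k n) (hS k n)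
  have hpow : ∀ k : ℕ, ENNReal.ofReal ((1 / 2) ^ k) = (2 : ℝ≥0∞)⁻¹ ^ k := by
    intro k
    rw [ENNReal.ofReal_pow (by norm_num), one_div, ENNReal.ofReal_inv_of_pos two_pos,
      ENNReal.ofReal_ofNat]
  simp only [hpow] at hlast hclose
  -- One ultrafilter provides all limits at once, without diagonal extraction.
  let U : Ultrafilter ℕ := hyperfilter ℕ
  have hU : (U : Filter ℕ) ≤ atTop := Nat.hyperfilter_le_atTop
  -- the limit distances
  let I := Σ k, Fin (N k + 1)
  have hD : ∀ a b : I, ∃ r : ℝ≥0∞,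
      Tendsto (fun n => edist (x n a.1 a.2) (x n b.1 b.2)) U (𝓝 r) := by
    intro a b
    obtain ⟨r, -, hr⟩ := isCompact_univ.ultrafilter_le_nhds
      (U.map fun n => edist (x n a.1 a.2) (x n b.1 b.2)) (by simp)
    exact ⟨r, hr⟩
  choose D hD using hD
  obtain ⟨Y, _, y, _, _, hy⟩ := exists_complete_separable_realization.{u} D
    (fun a => tendsto_nhds_unique (hD a a) (by simp))
    (fun a b => tendsto_nhds_unique (hD a b) (by simpa only [edist_comm] using hD b a))
    (fun a b c => le_of_tendsto_of_tendsto' (hD a c) ((hD a b).add (hD b c))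
      fun n => edist_triangle _ _ _)
  let _ : MeasurableSpace Y := borel Y
  have : BorelSpace Y := ⟨rfl⟩
  -- the limit law of the indices
  let P : ∀ n, X n → ∀ k, Fin (N k + 1) := fun n z k => p n k z
  have hP : ∀ n, Measurable (P n) := fun n => measurable_pi_lambda _ fun k => hp n k
  obtain ⟨ν, _, hν⟩ := exists_measure_tendsto_of_isClopen U (fun n => (X n).μ.map (P n)) (M := M)
    fun n => by rw [Measure.map_apply (hP n) MeasurableSet.univ]; exact hM n
  have hcyl : ∀ k (A : Set (Fin (N k + 1))), IsClopen {κ : ∀ k, Fin (N k + 1) | κ k ∈ A} :=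
    fun k A => (isClopen_discrete A).preimage (continuous_apply k)
  have hνcyl : ∀ k (A : Set (Fin (N k + 1))),
      Tendsto (fun n => (X n).μ (p n k ⁻¹' A)) U (𝓝 (ν {κ | κ k ∈ A})) := by
    intro k A
    refine (hν _ (hcyl k A)).congr fun n => ?_
    rw [Measure.map_apply (hP n) (hcyl k A).isOpen.measurableSet]
    rfl
  obtain ⟨T, hT, hTrate⟩ := exists_measurable_limit_of_indices ν (fun k i => y ⟨k, i⟩)
    (fun k => le_of_tendsto' (hνcyl k {Fin.last (N k)}) fun n => hlast n k) (by
      intro k i j hi hj h0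
      rw [hy]
      refine le_of_tendsto (hD _ _) ?_
      -- Positive limit mass yields, for `U`-most `n`, an actual point of `X n` with both indices;
      -- it lies near both centres.
      have hclopen : IsClopen {κ : ∀ k, Fin (N k + 1) | κ k = i ∧ κ (k + 1) = j} :=
        (hcyl k {i}).inter (hcyl (k + 1) {j})
      filter_upwards [(hν _ hclopen).eventually_ne h0] with n hn
      rw [Measure.map_apply (hP n) hclopen.isOpen.measurableSet] at hn
      obtain ⟨z, hz⟩ := nonempty_of_measure_ne_zero hn
      obtain ⟨rfl, rfl⟩ : p n k z = i ∧ p n (k + 1) z = j := hz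
      calc _ ≤ edist (x n k (p n k z)) z + edist z (x n (k + 1) (p n (k + 1) z)) :=
            edist_triangle _ _ _
        _ ≤ 2⁻¹ ^ k + 2⁻¹ ^ (k + 1) := by
            rw [edist_comm]
            exact add_le_add (hclose n k z hi) (hclose n (k + 1) z hj)
        _ ≤ 2 * 2⁻¹ ^ k := by
            rw [two_mul]
            gcongr _ + ?_
            exact pow_le_pow_right_of_le_one' (by simp) k.le_succ)
  -- With completeness, this makes the finite measure `ν.map T` regular.
  have : SecondCountableTopology Y := UniformSpace.secondCountable_of_separable Y
  let Y' : DistanceMeasureSpace.{u} := { carrier := Y, μ := ν.map T }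
  have key : ∀ ε : ℝ≥0∞, 0 < ε → ∀ᶠ n in (U : Filter ℕ), ghlpDist (X n) Y' < ε := by
    intro ε hε
    -- The final bound is `η + η + η + 4 * η + η`, with `L = η⁻¹`.
    obtain ⟨η, hη0, hη⟩ := ENNReal.lt_iff_exists_nnreal_btwn.1
      (ENNReal.div_pos hε.ne' (by simp : (8 : ℝ≥0∞) ≠ ∞))
    have hη0' : 0 < η := by exact_mod_cast hη0
    obtain ⟨k, hk⟩ := ENNReal.exists_inv_two_pow_lt hη0.ne'
    obtain ⟨t, ht, hty⟩ := hTrate k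
    have hdist : ∀ᶠ n in (U : Filter ℕ), ∀ i j,
        min (edist (x n k i) (x n k j)) ((η⁻¹ : ℝ≥0) : ℝ≥0∞) ≤
          min (D ⟨k, i⟩ ⟨k, j⟩) (η⁻¹ : ℝ≥0) + 2 * η ∧
        min (D ⟨k, i⟩ ⟨k, j⟩) ((η⁻¹ : ℝ≥0) : ℝ≥0∞) ≤
          min (edist (x n k i) (x n k j)) (η⁻¹ : ℝ≥0) + 2 * η := by
      refine eventually_all.2 fun i => eventually_all.2 fun j => ?_
      exact ENNReal.eventually_le_add_of_tendsto
        ((min_le_right _ _).trans_lt ENNReal.coe_lt_top).ne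
        ((hD ⟨k, i⟩ ⟨k, j⟩).min tendsto_const_nhds) (by positivity)
    have hmass : ∀ᶠ n in (U : Filter ℕ), ∀ A : Set (Fin (N k + 1)),
        (X n).μ (p n k ⁻¹' A) ≤ ν {κ | κ k ∈ A} + η ∧
          ν {κ | κ k ∈ A} ≤ (X n).μ (p n k ⁻¹' A) + η :=
      eventually_all.2 fun A => ENNReal.eventually_le_add_of_tendsto (measure_ne_top _ _)
        (hνcyl k A) hη0
    filter_upwards [hdist, hmass] with n h1 h2
    refine (ghlpDist_le_of_discretization (X := X n) (Y := Y') ν hT rfl (hp n k)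
      (measurable_pi_apply k) (x n k) (fun i => y ⟨k, i⟩) hη0' (inv_pos.2 hη0') (hlast n k)
      (fun z hz => hclose n k z hz) ht hty (fun i j => ?_) (fun i j => ?_) h2).trans_lt ?_
    · exact (h1 i j).1.trans_eq (by rw [← hy])
    · exact le_of_eq_of_le (by rw [← hy]) (h1 i j).2
    · rw [ENNReal.coe_inv hη0'.ne', one_div, inv_inv]
      calc _ ≤ (η + η + η + 4 * η + η : ℝ≥0∞) := by gcongr
        _ = η * 8 := by ring
        _ < ε := ENNReal.mul_lt_of_lt_div hη
  -- A set in the hyperfilter is infinite, which allows extraction of an ordinary subsequence.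
  obtain ⟨φ, hφ, h⟩ := extraction_forall_of_frequently
    (P := fun m n => ghlpDist (X n) Y' < ((m : ℝ≥0∞) + 1)⁻¹) fun m =>
      ((key _ (by simp)).frequently).filter_mono hU
  refine ⟨⟨Y', ‹_›, ‹_›⟩, φ, hφ, ?_⟩
  refine tendsto_of_tendsto_of_tendsto_of_le_of_le tendsto_const_nhds ?_ (fun _ => zero_le)
    fun m => (h m).le
  have := (tendsto_add_atTop_iff_nat 1).2 ENNReal.tendsto_inv_nat_nhds_zero
  simpa using this

/-- Uniformly nearly finite sequences of spaces have convergent subsequences. -/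
lemma exists_subseq_tendsto (X : ℕ → CompleteSeparableDMS.{u}) (M : ℝ≥0)
    (hM : ∀ n, (X n).1.μ univ ≤ M)
    (hN : ∀ ε : ℝ, 0 < ε → ∃ N : ℕ, ∀ n, ∃ S : Finset (X n).1,
      S.card ≤ N ∧ (X n).1.μ (Metric.thickening ε (S : Set (X n).1))ᶜ ≤ ENNReal.ofReal ε) :
    ∃ (Y : CompleteSeparableDMS.{u}) (φ : ℕ → ℕ), StrictMono φ ∧
      Tendsto (fun n => ghlpDist (X (φ n)).1 Y.1) atTop (𝓝 0) := by
  -- Discretization needs a point. Spaces of measure zero, among them the empty one, are treated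
  -- apart.
  by_cases h : ∃ᶠ n in atTop, (X n).1.μ = 0
  · obtain ⟨φ, hφ, h0⟩ := extraction_of_frequently_atTop h
    refine ⟨X (φ 0), φ, hφ, ?_⟩
    simp [ghlpDist_eq_zero_of_measure_eq_zero (h0 _) (h0 0)]
  · obtain ⟨φ, hφ, h0⟩ := extraction_of_frequently_atTop (not_frequently.1 h).frequently
    obtain ⟨Y, ψ, hψ, hlim⟩ := exists_subseq_tendsto_of_nonempty (fun n => (X (φ n)).1)
      (fun n => by
        by_contra hn
        rw [not_nonempty_iff] at hn
        exact h0 n (Measure.eq_zero_of_isEmpty _)) M (fun n => hM _) fun ε hε => by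
        obtain ⟨N, hN⟩ := hN ε hε
        exact ⟨N, fun n => hN _⟩
    exact ⟨Y, φ ∘ ψ, hφ.comp hψ, hlim⟩

lemma exists_ghlpDist_lt_of_lt (ε : ℝ≥0∞) (hε : ε > 0) :
    ∃ δ > 0, ∀ X Y W : CompleteSeparableDMS.{u}, ghlpDist X.1 Y.1 < δ → ghlpDist Y.1 W.1 < δ →
      ghlpDist X.1 W.1 < ε := by
  obtain ⟨δ, hδ0, hδ⟩ := exists_between (ENNReal.div_pos hε.ne' (by simp : (4 : ℝ≥0∞) ≠ ∞))
  refine ⟨δ, hδ0, fun X Y W h h' => (ghlpDist_le_two_mul_add h h').trans_lt ?_⟩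
  calc 2 * (δ + δ) = δ * 4 := by ring
    _ < ε := ENNReal.mul_lt_of_lt_div hδ

end Precompactness

theorem mainTheorem1 (𝔉 : Set CompleteSeparableDMS.{u}) (M : ℝ≥0)
    (hM : ∀ X ∈ 𝔉, X.1.μ univ ≤ (M : ℝ≥0∞))
    (hN : ∀ ε : ℝ, 0 < ε → ∃ N : ℕ, ∀ X ∈ 𝔉, ∃ S : Finset X.1,
      S.card ≤ N ∧ X.1.μ (Metric.thickening ε (S : Set X.1))ᶜ ≤ ENNReal.ofReal ε) :
    -- the family is totally bounded for `d_ρ`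
    (∀ ε : ℝ≥0∞, 0 < ε → ∃ F : Set CompleteSeparableDMS.{u}, F ⊆ 𝔉 ∧ F.Finite ∧
      ∀ X ∈ 𝔉, ∃ Y ∈ F, ghlpDist X.1 Y.1 < ε) ∧
    -- every sequence in the family has a subsequence that converges for `d_ρ`
    (∀ X : ℕ → CompleteSeparableDMS.{u}, (∀ n, X n ∈ 𝔉) →
      ∃ (Y : CompleteSeparableDMS.{u}) (φ : ℕ → ℕ), StrictMono φ ∧
        Tendsto (fun n => ghlpDist (X (φ n)).1 Y.1) atTop (𝓝 0)) ∧
    -- the closure of the family is compact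
    IsCompact (closure 𝔉) := by
  -- Both total boundedness and compactness are deduced from this.
  have hseq : ∀ X : ℕ → CompleteSeparableDMS.{u}, (∀ n, X n ∈ 𝔉) →
      ∃ (Y : CompleteSeparableDMS.{u}) (φ : ℕ → ℕ), StrictMono φ ∧
        Tendsto (fun n => ghlpDist (X (φ n)).1 Y.1) atTop (𝓝 0) := fun X hX =>
    exists_subseq_tendsto X M (fun n => hM _ (hX n)) fun ε hε => by
      obtain ⟨N, hN⟩ := hN ε hε
      exact ⟨N, fun n => hN _ (hX n)⟩
  refine ⟨fun ε hε => ?_, hseq, ?_⟩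
  · exact exists_finite_net_of_seq_precompact (d := fun X Y : CompleteSeparableDMS.{u} => ghlpDist X.1 Y.1)
      (fun X Y => ghlpDist_comm _ _) exists_ghlpDist_lt_of_lt hseq hε
  · exact isCompact_closure_of_seq_precompact (d := fun X Y : CompleteSeparableDMS.{u} => ghlpDist X.1 Y.1)
      (fun U => Iff.rfl)
      (fun X => ghlpDist_self _) (fun X Y => ghlpDist_comm _ _) exists_ghlpDist_lt_of_lt hseq
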